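/- **Setting.** Let $\mathcal X$ be a separable, completely metrizable, locally convex (Hausdorff) topological vector space over $\mathbb R$, and let $\mathcal X^{*}$ be its topological dual with the weak$^*$ topology. Let $\mathcal X^{+}\subseteq\mathcal X$ be a convex cone, that is, $\lambda A\in\mathcal X^{+}$ and $A+B\in\mathcal X^{+}$ for all $A,B\in\mathcal X^{+}$ and $\lambda>0$. Write $A\preceq B$ if $B-A\in\mathcal X^{+}$, and $[A_1,A_2]=\{A\in\mathcal X: A_1\preceq A\preceq A_2\}$. Let $\mathcal X^{*,+}=\{\sigma\in\mathcal X^{*}:\sigma(A)\ge 0\text{ for all }A\in\mathcal X^{+}\}$. For a $0$-neighbourhood $\mathcal U\subseteq\mathcal X$ let $\mathcal U^{\circ}=\{\sigma\in\mathcal X^*: |\sigma(A)|\le 1\text{ for all }A\in\mathcal U\}$, and let $\mathbf{CU}_{\mathcal U}(\mathcal X^*)$ be the set of all nonempty convex weak$^*$-closed subsets of $\mathcal U^{\circ}$. Let $\mathbf{CU}(\mathcal X^{*,+})$ be the set of all $K\subseteq\mathcal X^{*,+}$ that belong to $\mathbf{CU}_{\mathcal U}(\mathcal X^*)$ for some $0$-neighbourhood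 $\mathcal U$. Let $\mathcal D$ be the set of all $K$ that belong to $\mathbf{CU}_{\mathcal U}(\mathcal X^*)$ for some $0$-neighbourhood $\mathcal U$ and equal the weak$^*$ closure of their set $\mathcal E(K)$ of extreme points, and let $\mathcal D^{+}=\mathcal D\cap\mathbf{CU}(\mathcal X^{*,+})$. The weak$^*$-Hausdorff hypertopology on the set of nonempty weak$^*$-closed subsets of $\mathcal X^*$ is the topology generated by the family of $[0,\infty]$-valued pseudometrics $$d_H^{(A)}(F,G)=\max\Big\{\sup_{\sigma\in F}\inf_{\tau\in G}|(\sigma-\tau)(A)|,\ \sup_{\tau\in G}\inf_{\sigma\in F}|(\sigma-\tau)(A)|\Big\},\qquad A\in\mathcal X,$$ and $\mathbf{CU}(\mathcal X^{*,+})$ carries the subspace topology. **Theorem (Generic convex weak$^*$-compact sets - Positive functionals).** Assume that 1. for every $0$-neighbourhood $\mathcal U$ in $\mathcal X$ there are $A_1,A_2\in\mathcal X$ and a $0$-neighbourhood $\tilde{\mathcal U}$ with $\tilde{\mathcal U}\subseteq[A_1,A_2]\subseteq\mathcal U$; 2. there are a $0$-neighbourhood $\mathcal U$ in $\mathcal X$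 and a sequence $(\sigma_n)_{n\in\mathbb N}$ of linearly independent elements of $\mathcal X^*$ such that $\sup_{A\in\mathcal U}|\sigma_n(A)|<\infty$ for every $n$. Then $\mathcal D^{+}$ is a dense $G_\delta$ subset of $\mathbf{CU}(\mathcal X^{*,+})$ in the weak$^*$-Hausdorff hypertopology. -/

import Mathlib

open Set Topology

namespace WeakStarHyper

noncomputable section

variable (X : Type*) [AddCommGroup X] [Module ℝ X] [TopologicalSpace X]

/-- The hyperspace `F(X*)` of all nonempty weak*-closed subsets of the topological dual of `X`
(`WeakDual ℝ X` is the dual space with the weak* topology). -/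
def HyperF : Type _ := {F : Set (WeakDual ℝ X) // F.Nonempty ∧ IsClosed F}

variable {X}

/-- The Hausdorff pseudometric `d_H^{(A)}`, with values in `[0, ∞]`:
the maximum of `sup_{σ ∈ F} inf_{τ ∈ G} |(σ - τ)(A)|` and
`sup_{τ ∈ G} inf_{σ ∈ F} |(σ - τ)(A)|`. -/
def dH (A : X) (F G : HyperF X) : ENNReal :=
  max (⨆ σ ∈ F.1, ⨅ τ ∈ G.1, ENNReal.ofReal |(σ - τ) A|)
    (⨆ τ ∈ G.1, ⨅ σ ∈ F.1, ENNReal.ofReal |(σ - τ) A|)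

theorem dH_eq_hausdorffEDist (A : X) (F G : HyperF X) :
    dH A F G = Metric.hausdorffEDist ((fun σ : WeakDual ℝ X => σ A) '' F.1)
      ((fun σ : WeakDual ℝ X => σ A) '' G.1) := by
  have h : ∀ σ τ : WeakDual ℝ X, ENNReal.ofReal |(σ - τ) A| = edist (σ A) (τ A) := by
    intro σ τ
    rw [edist_dist, Real.dist_eq]
    rfl
  simp only [dH, Metric.hausdorffEDist_def, Metric.infEDist, iSup_image, iInf_image, h]
  congr 1
  simp only [edist_comm]

/-- `d_H^{(A)}` as an (extended) pseudometric structure on `F(X*)`. -/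
@[reducible]
def pseudoMetric (A : X) : PseudoEMetricSpace (HyperF X) where
  edist := dH A
  edist_self F := by
    simpa only [dH_eq_hausdorffEDist] using Metric.hausdorffEDist_self
  edist_comm F G := by
    simpa only [dH_eq_hausdorffEDist] using Metric.hausdorffEDist_comm
  edist_triangle F G H := by
    simpa only [dH_eq_hausdorffEDist] using Metric.hausdorffEDist_triangle

/-- The weak*-Hausdorff hypertopology on `F(X*)`: the topology generated by the family of
pseudometrics `d_H^{(A)}`, `A ∈ X` (the coarsest topology finer than each of the pseudometric
topologies). -/
instance : TopologicalSpace (HyperF X) :=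
  ⨅ A : X, (pseudoMetric A).toUniformSpace.toTopologicalSpace

/-- The absolute polar of a set `U ⊆ X`. -/
def absPolar (U : Set X) : Set (WeakDual ℝ X) := {σ | ∀ A ∈ U, |σ A| ≤ 1}

/-- `CU_U(X*)`: the nonempty convex weak*-closed sets contained in the absolute polar of `U`. -/
def CUof (U : Set X) : Set (HyperF X) := {K | Convex ℝ K.1 ∧ K.1 ⊆ absPolar U}

/-- `D_U`: the elements `K` of `CU_U(X*)` whose extreme boundary is weak*-dense in `K`. -/
def Dof (U : Set X) : Set (HyperF X) :=
  {K | K ∈ CUof U ∧ K.1 = closure (K.1.extremePoints ℝ)}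

variable (X) in
/-- `D`: the union of the sets `D_U` over all `0`-neighbourhoods `U`. -/
def D : Set (HyperF X) := ⋃ U ∈ 𝓝 (0 : X), Dof U

/-- The continuous positive functionals with respect to a convex cone `C`. -/
def posDual (C : ConvexCone ℝ X) : Set (WeakDual ℝ X) := {σ | ∀ A ∈ C, 0 ≤ σ A}

/-- `CU(X*,+)`: the union over all `0`-neighbourhoods `U` of the sets of those elements of
`CU_U(X*)` that consist of positive functionals. -/
def CUpos (C : ConvexCone ℝ X) : Set (HyperF X) :=
  ⋃ U ∈ 𝓝 (0 : X), {K | K ∈ CUof U ∧ K.1 ⊆ posDual C}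

/-- `D⁺ = D ∩ CU(X*,+)`. -/
def Dpos (C : ConvexCone ℝ X) : Set (HyperF X) := D X ∩ CUpos C

/-- The interval `[A₁, A₂]` for the preorder `A ≼ B ↔ B - A ∈ C` defined by the cone `C`. -/
def orderInterval (C : ConvexCone ℝ X) (A₁ A₂ : X) : Set X :=
  {A | A - A₁ ∈ C ∧ A₂ - A ∈ C}

/-- Infinite-dimensionality condition on `U`: there is an infinite sequence of linearly
independent continuous linear functionals, each of which is bounded on `U`. -/
def InfDimCondition (U : Set X) : Prop :=
  ∃ σ : ℕ → WeakDual ℝ X, LinearIndependent ℝ σ ∧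
    ∀ n, BddAbove ((fun A : X => |σ n A|) '' U)

end

end WeakStarHyper

/-! Members of `CUpos C` are weak*-compact, and both halves of the theorem exploit the geometry of
their extreme points.

$G_\delta$: every neighbourhood of an extreme point of a compact convex $K$ contains a slice of $K$,
and every nonempty slice contains an extreme point. Hence density of the extreme points amounts to
countably many instances of `SliceCondition`, indexed by finite families of rational strips at a
dense sequence (`subset_closure_extremePoints_iff`). Each instance asks only that $K$ miss closed
convex sets or meet an open half-space. Although a pseudometric sees just one evaluation,
Hahn–Banach separation makes such requirements open (`eventually_sliceCondition`).

Density (`exists_mem_Dpos_dH_le`): choose a positive $\varphi$ dominating, up to scalars, infinitely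
many independent positive functionals. With $\sigma_0\in K$, let
$L=K-\sigma_0+\varepsilon[-\varphi,\varphi]$, with gauge $g$, and let $q$ be a small multiple of the
strictly convex $\sum_n 2^{-n}\sigma(y_n)^2$. Points of $S=\{g+q\le 1\}$ with $g+q=1$ are extreme.
Any weak* neighbourhood of a point of $S$ contains a full line through it in a direction absorbed by
$L$, and this line leaves the compact set $S$ at an extreme point. Translating $S$ by
$\sigma_0+\varepsilon\varphi$ restores positivity and gives a set at distance $O(\varepsilon)$ from
$K$ for each pseudometric. -/

open scoped Pointwise

/-! ### Sublevel sets of a gauge plus a convex function -/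

section GaugeAddSublevel

variable {E : Type*} [AddCommGroup E] [Module ℝ E] {L : Set E} {q : E → ℝ}

theorem Convex.combo_mem_smul (hL : Convex ℝ L) {x y : E} {r s a b : ℝ} (hr : 0 ≤ r)
    (hs : 0 ≤ s) (ha : 0 ≤ a) (hb : 0 ≤ b) (hx : x ∈ r • L) (hy : y ∈ s • L) :
    a • x + b • y ∈ (a * r + b * s) • L := by
  rw [hL.add_smul (by positivity) (by positivity), mul_smul, mul_smul]
  exact Set.add_mem_add (Set.smul_mem_smul_set hx) (Set.smul_mem_smul_set hy)

/-- For a convex set `L` containing `0` with gauge `g`, this is the sublevel set `g + q ≤ 1`. -/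
def gaugeAddSublevel (L : Set E) (q : E → ℝ) : Set E :=
  {x | ∃ t : ℝ, 0 ≤ t ∧ x ∈ t • L ∧ t + q x ≤ 1}

theorem gaugeAddSublevel_subset (hL : Convex ℝ L) (h0 : 0 ∈ L) (hq : ∀ x, 0 ≤ q x) :
    gaugeAddSublevel L q ⊆ L := by
  rintro _ ⟨t, ht, ⟨x, hx, rfl⟩, h⟩
  exact hL.smul_mem_of_zero_mem h0 hx ⟨ht, by linarith [hq (t • x)]⟩

theorem convex_gaugeAddSublevel (hL : Convex ℝ L) (hq : ConvexOn ℝ univ q) :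
    Convex ℝ (gaugeAddSublevel L q) := by
  rintro x ⟨r, hr, hx, hxr⟩ y ⟨s, hs, hy, hys⟩ a b ha hb hab
  refine ⟨a * r + b * s, by positivity, hL.combo_mem_smul hr hs ha hb hx hy, ?_⟩
  have := hq.2 (mem_univ x) (mem_univ y) ha hb hab
  simp only [smul_eq_mul] at this
  nlinarith

/-- A proper convex combination of two distinct points of the set would have $g+q<1$, by convexity
of $g$ and strict convexity of $q$. Witnesses $t$ replace the value of $g$, which is infinite
outside the cone generated by `L`. -/
theorem mem_extremePoints_gaugeAddSublevel (hL : Convex ℝ L) (hq : StrictConvexOn ℝ univ q)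
    {x : E} (hx : x ∈ gaugeAddSublevel L q)
    (hx' : ¬ ∃ t : ℝ, 0 ≤ t ∧ x ∈ t • L ∧ t + q x < 1) :
    x ∈ (gaugeAddSublevel L q).extremePoints ℝ := by
  rw [mem_extremePoints_iff_left]
  refine ⟨hx, ?_⟩
  rintro y ⟨r, hr, hy, hyr⟩ z ⟨s, hs, hz, hzs⟩ ⟨a, b, ha, hb, hab, rfl⟩
  by_contra hne
  have hyz : y ≠ z := by
    rintro rfl
    exact hne (by rw [← add_smul, hab, one_smul])
  refine hx' ⟨a * r + b * s, by positivity, hL.combo_mem_smul hr hs ha.le hb.le hy hz, ?_⟩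
  have := hq.2 (mem_univ y) (mem_univ z) hyz ha hb hab
  simp only [smul_eq_mul] at this
  nlinarith

end GaugeAddSublevel

/-! ### Translates of sets with dense extreme points -/

section Translation

variable {E : Type*} [AddCommGroup E] [Module ℝ E] [TopologicalSpace E]
  [IsTopologicalAddGroup E]

theorem image_add_left_subset_closure_extremePoints {S : Set E} (a : E)
    (h : S ⊆ closure (S.extremePoints ℝ)) :
    (fun x => a + x) '' S ⊆ closure (((fun x => a + x) '' S).extremePoints ℝ) := by
  have hsub : (fun x => a + x) '' S.extremePoints ℝ ⊆
      ((fun x => a + x) '' S).extremePoints ℝ := by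
    rintro _ ⟨x, hx, rfl⟩
    rw [mem_extremePoints_iff_left]
    refine ⟨mem_image_of_mem _ hx.1, ?_⟩
    rintro _ ⟨y, hy, rfl⟩ _ ⟨z, hz, rfl⟩ hxyz
    rw [mem_openSegment_translate] at hxyz
    rw [(mem_extremePoints_iff_left.1 hx).2 y hy z hz hxyz]
  exact (image_mono h).trans ((image_closure_subset_closure_image (by fun_prop)).trans
    (closure_mono hsub))

end Translation

/-! ### Slices, extreme points and compactness -/

section Convexity

variable {E : Type*} [AddCommGroup E] [Module ℝ E] [TopologicalSpace E]
  [IsTopologicalAddGroup E] [ContinuousSMul ℝ E]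

theorem isCompact_convexJoin {P Q : Set E} (hP : IsCompact P) (hQ : IsCompact Q) :
    IsCompact (convexJoin ℝ P Q) := by
  have h : convexJoin ℝ P Q =
      (fun z : ℝ × E × E => (1 - z.1) • z.2.1 + z.1 • z.2.2) '' (Icc 0 1 ×ˢ P ×ˢ Q) := by
    ext x
    simp only [mem_convexJoin, segment_eq_image, mem_image, Prod.exists, mem_prod]
    constructor
    · rintro ⟨a, ha, b, hb, t, ht, rfl⟩
      exact ⟨t, a, b, ⟨ht, ha, hb⟩, rfl⟩
    · rintro ⟨t, a, b, ⟨ht, ha, hb⟩, rfl⟩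
      exact ⟨a, ha, b, hb, t, ht, rfl⟩
  rw [h]
  exact (isCompact_Icc.prod (hP.prod hQ)).image (by fun_prop)

/-- An extreme point of a compact convex set `K` lies outside some compact convex subset of `K`
that contains the traces on `K` of finitely many given closed convex sets avoiding the point. -/
theorem exists_compact_convex_of_mem_extremePoints [T2Space E] {K : Set E} (hK : IsCompact K)
    (hKc : Convex ℝ K) {e : E} (he : e ∈ K.extremePoints ℝ) {ι : Type*} (s : Finset ι)
    {P : ι → Set E} (hPc : ∀ i ∈ s, IsClosed (P i)) (hPx : ∀ i ∈ s, Convex ℝ (P i))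
    (heP : ∀ i ∈ s, e ∉ P i) :
    ∃ Q ⊆ K, IsCompact Q ∧ Convex ℝ Q ∧ e ∉ Q ∧ ∀ i ∈ s, K ∩ P i ⊆ Q := by
  classical
  induction s using Finset.induction_on with
  | empty => exact ⟨∅, empty_subset _, isCompact_empty, convex_empty, by simp, by simp⟩
  | insert i s _ ih =>
    simp only [Finset.forall_mem_insert] at hPc hPx heP
    obtain ⟨Q, hQK, hQ, hQx, heQ, hsub⟩ := ih hPc.2 hPx.2 heP.2
    have hR : IsCompact (K ∩ P i) := hK.inter_right hPc.1
    have hRx : Convex ℝ (K ∩ P i) := hKc.inter hPx.1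
    simp only [Finset.forall_mem_insert]
    -- A join with the empty set is empty, so the degenerate cases are separate.
    rcases Q.eq_empty_or_nonempty with rfl | hQne
    · exact ⟨K ∩ P i, inter_subset_left, hR, hRx, fun h => heP.1 h.2, Subset.rfl,
        fun j hj => (hsub j hj).trans (empty_subset _)⟩
    rcases (K ∩ P i).eq_empty_or_nonempty with hemp | hRne
    · exact ⟨Q, hQK, hQ, hQx, heQ, hemp ▸ empty_subset _, hsub⟩
    refine ⟨convexJoin ℝ Q (K ∩ P i), convexJoin_subset hQK inter_subset_left hKc,
      isCompact_convexJoin hQ hR, hQx.convexJoin hRx, fun h => ?_, subset_convexJoin_right hQne,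
      fun j hj => (hsub j hj).trans (subset_convexJoin_left hRne)⟩
    obtain ⟨a, ha, b, hb, hab⟩ := mem_convexJoin.1 h
    rcases (mem_extremePoints_iff_forall_segment.1 he).2 a (hQK ha) b hb.1 hab with rfl | rfl
    · exact heQ ha
    · exact heP.1 hb.2

/-- Slices form a neighbourhood base at an extreme point. -/
theorem exists_slice_of_mem_extremePoints [T2Space E] [LocallyConvexSpace ℝ E] {K : Set E}
    (hK : IsCompact K) (hKc : Convex ℝ K) {e : E} (he : e ∈ K.extremePoints ℝ) {ι : Type*}
    (s : Finset ι) {P : ι → Set E} (hPc : ∀ i ∈ s, IsClosed (P i))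
    (hPx : ∀ i ∈ s, Convex ℝ (P i)) (heP : ∀ i ∈ s, e ∉ P i) :
    ∃ l : E →L[ℝ] ℝ, ∃ c, c < l e ∧ ∀ x ∈ K, c ≤ l x → ∀ i ∈ s, x ∉ P i := by
  obtain ⟨Q, -, hQ, hQx, heQ, hsub⟩ :=
    exists_compact_convex_of_mem_extremePoints hK hKc he s hPc hPx heP
  obtain ⟨l, c, hlc, hc⟩ := geometric_hahn_banach_closed_point hQx hQ.isClosed heQ
  exact ⟨l, c, hc, fun x hx hcx i hi hxi => (hlc x (hsub i hi ⟨hx, hxi⟩)).not_ge hcx⟩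

/-- Every nonempty slice of a compact set contains an extreme point of the set. -/
theorem exists_extremePoint_mem_slice [T2Space E] [LocallyConvexSpace ℝ E] {K : Set E}
    (hK : IsCompact K) (l : E →L[ℝ] ℝ) {c : ℝ} (h : ∃ x ∈ K, c < l x) :
    ∃ x ∈ K.extremePoints ℝ, c < l x := by
  obtain ⟨x, hx, hcx⟩ := h
  -- The face where `l` is maximal is compact, so it has an extreme point, and extreme points of an
  -- exposed face are extreme in `K`.
  have hexp : IsExposed ℝ K {y ∈ K | ∀ z ∈ K, l z ≤ l y} := fun _ => ⟨l, rfl⟩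
  obtain ⟨z, hzK, hz⟩ := hK.exists_isMaxOn ⟨x, hx⟩ l.continuous.continuousOn
  obtain ⟨y, hy⟩ := (hexp.isCompact hK).extremePoints_nonempty ⟨z, hzK, hz⟩
  exact ⟨y, hexp.isExtreme.extremePoints_subset_extremePoints hy, hcx.trans_le (hy.1.2 x hx)⟩

variable {L : Set E} {q : E → ℝ}

-- The set is the image under scalar multiplication of a compact subset of $[0,1]\times L$. This
-- requires no continuity of the gauge, and continuity of `q` only on `L`.
omit [IsTopologicalAddGroup E] in
theorem isCompact_gaugeAddSublevel (hLc : IsCompact L) (hL : Convex ℝ L) (h0 : 0 ∈ L)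
    (hq : ∀ x, 0 ≤ q x) (hqc : ContinuousOn q L) : IsCompact (gaugeAddSublevel L q) := by
  have hmaps : MapsTo (fun z : ℝ × E => z.1 • z.2) (Icc 0 1 ×ˢ L) L :=
    fun z hz => hL.smul_mem_of_zero_mem h0 hz.2 hz.1
  have hcont : ContinuousOn (fun z : ℝ × E => z.1 + q (z.1 • z.2)) (Icc 0 1 ×ˢ L) :=
    continuousOn_fst.add (hqc.comp (by fun_prop) hmaps)
  have hcl : IsCompact {z ∈ Icc (0 : ℝ) 1 ×ˢ L | z.1 + q (z.1 • z.2) ≤ 1} := by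
    have hcpt : IsCompact (Icc (0 : ℝ) 1 ×ˢ L) := isCompact_Icc.prod hLc
    obtain ⟨u, hu, h⟩ := continuousOn_iff_isClosed.1 hcont (Iic 1) isClosed_Iic
    have : {z ∈ Icc (0 : ℝ) 1 ×ˢ L | z.1 + q (z.1 • z.2) ≤ 1} = (Icc (0 : ℝ) 1 ×ˢ L) ∩ u := by
      rw [inter_comm, ← h, inter_comm]
      rfl
    rw [this]
    exact hcpt.inter_right hu
  convert hcl.image (f := fun z : ℝ × E => z.1 • z.2) (by fun_prop) using 1
  ext x
  simp only [mem_image, Prod.exists, mem_ofPred_eq, mem_prod]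
  constructor
  · rintro ⟨t, ht, ⟨y, hy, rfl⟩, h⟩
    exact ⟨t, y, ⟨⟨⟨ht, by linarith [hq (t • y)]⟩, hy⟩, h⟩, rfl⟩
  · rintro ⟨t, y, ⟨⟨ht, hy⟩, h⟩, rfl⟩
    exact ⟨t, ht.1, ⟨y, hy, rfl⟩, h⟩

/-- If `L` absorbs, inside every neighbourhood of `0`, the half-line spanned by a nonzero vector
whose whole line lies in that neighbourhood, then the extreme points of `gaugeAddSublevel L q` are
dense. -/
theorem gaugeAddSublevel_subset_closure_extremePoints [T2Space E] (hLc : IsCompact L)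
    (hL : Convex ℝ L) (h0 : 0 ∈ L) (hq : StrictConvexOn ℝ univ q) (hq0 : ∀ x, 0 ≤ q x)
    (hqc : ContinuousOn q L)
    (habs : ∀ O ∈ 𝓝 (0 : E), ∃ v ≠ (0 : E), (∀ s : ℝ, s • v ∈ O) ∧ ∃ r : ℝ, 0 < r ∧ v ∈ r • L) :
    gaugeAddSublevel L q ⊆ closure ((gaugeAddSublevel L q).extremePoints ℝ) := by
  intro p hp
  rw [mem_closure_iff_nhds]
  intro O hO
  have hO' : (fun y => p + y) ⁻¹' O ∈ 𝓝 (0 : E) := by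
    apply (continuous_const.add continuous_id).continuousAt.preimage_mem_nhds
    simpa using hO
  obtain ⟨v, hv0, hvO, r, hr, hvr⟩ := habs _ hO'
  have hcpt : IsCompact ((fun s : ℝ => p + s • v) ⁻¹' gaugeAddSublevel L q) := by
    have hemb : IsClosedEmbedding (fun s : ℝ => p + s • v) :=
      (Homeomorph.addLeft p).isClosedEmbedding.comp (isClosedEmbedding_smul_left hv0)
    exact hemb.isCompact_preimage (isCompact_gaugeAddSublevel hLc hL h0 hq0 hqc)
  -- The last point of the line in the set. Slack in $g+q\le1$ there would allow a further step
  -- along `v`.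
  obtain ⟨s, hs, hmax⟩ := hcpt.exists_isMaxOn ⟨0, by simpa using hp⟩ continuousOn_id
  refine ⟨p + s • v, hvO s, mem_extremePoints_gaugeAddSublevel hL hq hs ?_⟩
  rintro ⟨t, ht, htL, hlt⟩
  set x := p + s • v with hx
  clear_value x
  set g := 1 - (t + q x) with hg
  have hg0 : 0 < g := by linarith
  have hqv := hq0 (x + v)
  -- A step `δ` costs at most $\delta r$ in the gauge and $\delta q(x+v)$ in `q`, less than the
  -- slack `g`. The extra `g` in the denominator gives $\delta\le 1$, needed for convexity of `q`.
  set δ := g / (g + r + q (x + v)) with hδ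
  have hD : 0 < g + r + q (x + v) := by linarith
  have hδ0 : 0 < δ := div_pos hg0 hD
  have hδD : δ * (g + r + q (x + v)) = g := div_mul_cancel₀ _ hD.ne'
  have hδ1 : δ ≤ 1 := (div_le_one hD).2 (by linarith)
  have hmem : s + δ ∈ (fun s : ℝ => p + s • v) ⁻¹' gaugeAddSublevel L q := by
    have heq : p + (s + δ) • v = x + δ • v := by rw [hx, add_smul, add_assoc]
    simp only [mem_preimage, heq]
    refine ⟨t + δ * r, by positivity, ?_, ?_⟩
    · simpa using hL.combo_mem_smul ht hr.le zero_le_one hδ0.le htL hvr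
    · have h := hq.convexOn.2 (mem_univ x) (mem_univ (x + v)) (sub_nonneg.2 hδ1) hδ0.le
        (sub_add_cancel 1 δ)
      have heq' : (1 - δ) • x + δ • (x + v) = x + δ • v := by
        rw [smul_add, ← add_assoc, ← add_smul, sub_add_cancel, one_smul]
      rw [heq'] at h
      simp only [smul_eq_mul] at h
      nlinarith [mul_nonneg hδ0.le (hq0 x), mul_pos hδ0 hg0]
  have := hmax hmem
  simp only [id, mem_ofPred_eq] at this
  linarith

end Convexity

namespace WeakStarHyper

/-! ### Weak* compactness and separation -/

section WeakDual

variable {X : Type*} [AddCommGroup X] [Module ℝ X] [TopologicalSpace X]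

instance : LocallyConvexSpace ℝ (WeakDual ℝ X) :=
  inferInstanceAs (LocallyConvexSpace ℝ (WeakBilin (topDualPairing ℝ X)))

/-- The weak*-continuous functional given by evaluation at a point. -/
noncomputable def evalCLM (A : X) : WeakDual ℝ X →L[ℝ] ℝ where
  toFun σ := σ A
  map_add' _ _ := rfl
  map_smul' _ _ := rfl
  cont := WeakDual.eval_continuous A

theorem exists_eq_eval (f : WeakDual ℝ X →L[ℝ] ℝ) : ∃ A : X, ∀ σ, f σ = σ A := by
  obtain ⟨A, hA⟩ := LinearMap.dualEmbedding_surjective (topDualPairing ℝ X) f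
  exact ⟨A, fun σ => by rw [← hA]; rfl⟩

/-- Banach–Alaoglu: a linear map bounded on a neighbourhood of `0` is automatically continuous, so
the polar embeds as a closed subset of a product of intervals. -/
theorem isCompact_absPolar [IsTopologicalAddGroup X] [ContinuousSMul ℝ X] {U : Set X}
    (hU : U ∈ 𝓝 (0 : X)) : IsCompact (absPolar U) := by
  have hemb : IsEmbedding (fun (σ : WeakDual ℝ X) (A : X) => σ A) :=
    WeakBilin.isEmbedding ContinuousLinearMap.coe_injective
  have habs : ∀ A : X, ∃ c : ℝ, 0 < c ∧ c • A ∈ U := by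
    intro A
    have : ∀ᶠ c : ℝ in 𝓝 0, c • A ∈ U := by
      have hc : ContinuousAt (fun c : ℝ => c • A) 0 := by fun_prop
      exact hc.eventually (by simpa using hU)
    obtain ⟨c, hc, h⟩ := ((this.filter_mono nhdsWithin_le_nhds).and
      (self_mem_nhdsWithin : Ioi (0 : ℝ) ∈ 𝓝[>] 0)).exists
    exact ⟨c, h, hc⟩
  choose c hc0 hcU using habs
  rw [hemb.isCompact_iff]
  have hcpt : IsCompact (univ.pi fun A : X => Icc (-(c A)⁻¹) (c A)⁻¹) :=
    isCompact_univ_pi fun A => isCompact_Icc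
  have himage : (fun (σ : WeakDual ℝ X) (A : X) => σ A) '' absPolar U =
      (univ.pi fun A : X => Icc (-(c A)⁻¹) (c A)⁻¹) ∩ {f | (∀ A B, f (A + B) = f A + f B) ∧
        (∀ (r : ℝ) A, f (r • A) = r * f A) ∧ ∀ A ∈ U, |f A| ≤ 1} := by
    ext f
    constructor
    · rintro ⟨σ, hσ, rfl⟩
      refine ⟨fun A _ => ?_, map_add σ, fun r A => by simp, hσ⟩
      have h := hσ _ (hcU A)
      rw [map_smul, smul_eq_mul, abs_mul, abs_of_pos (hc0 A)] at h
      exact abs_le.1 (by rwa [← mul_one (c A)⁻¹, le_inv_mul_iff₀ (hc0 A)])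
    · rintro ⟨-, hadd, hsmul, hb⟩
      let g : X →ₗ[ℝ] ℝ := { toFun := f, map_add' := hadd, map_smul' := hsmul }
      have hg : Continuous g := by
        refine (g.clmOfExistsBoundedImage ⟨U, hU, ?_⟩).continuous
        refine (NormedSpace.isVonNBounded_closedBall ℝ ℝ 1).subset ?_
        rintro _ ⟨A, hA, rfl⟩
        simpa using! hb A hA
      exact ⟨StrongDual.toWeakDual ⟨g, hg⟩, hb, rfl⟩
  rw [himage]
  refine hcpt.inter_right ?_
  simp only [ofPred_and, ofPred_forall]
  refine IsClosed.inter ?_ (IsClosed.inter ?_ ?_)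
  · exact isClosed_iInter fun A => isClosed_iInter fun B =>
      isClosed_eq (by fun_prop) (by fun_prop)
  · exact isClosed_iInter fun r => isClosed_iInter fun A =>
      isClosed_eq (by fun_prop) (by fun_prop)
  · exact isClosed_iInter fun A => isClosed_iInter fun _ =>
      isClosed_le (continuous_apply _).abs continuous_const

theorem exists_forall_abs_apply_le {K : Set (WeakDual ℝ X)} (hK : IsCompact K) (A : X) :
    ∃ M, 0 ≤ M ∧ ∀ σ ∈ K, |σ A| ≤ M := by
  obtain ⟨M, hM⟩ := (hK.image (WeakDual.eval_continuous A).abs).bddAbove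
  exact ⟨max M 0, le_max_right _ _, fun σ hσ =>
    (hM (mem_image_of_mem _ hσ)).trans (le_max_left _ _)⟩

/-- A compact convex set and a disjoint closed convex set of functionals are strictly separated by
a point of the predual. -/
theorem exists_strict_separation {K F : Set (WeakDual ℝ X)} (hK : IsCompact K)
    (hKc : Convex ℝ K) (hF : IsClosed F) (hFc : Convex ℝ F) (h : Disjoint K F) :
    ∃ A : X, ∃ u v : ℝ, u < v ∧ (∀ σ ∈ K, σ A < u) ∧ ∀ σ ∈ F, v < σ A := by
  obtain ⟨f, u, v, h1, huv, h2⟩ := geometric_hahn_banach_compact_closed hKc hK hFc hF h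
  obtain ⟨A, hA⟩ := exists_eq_eval f
  exact ⟨A, u, v, huv, fun σ hσ => hA σ ▸ h1 σ hσ, fun σ hσ => hA σ ▸ h2 σ hσ⟩

end WeakDual

/-! ### Open conditions in the hypertopology and the slice criterion -/

section Hyperspace

variable {X : Type*} [AddCommGroup X] [Module ℝ X] [TopologicalSpace X]

theorem nhds_hyperF (K : HyperF X) :
    𝓝 K = ⨅ A : X, @nhds _ (pseudoMetric A).toUniformSpace.toTopologicalSpace K :=
  nhds_iInf

theorem dH_lt_mem_nhds (K : HyperF X) (A : X) {ε : ENNReal} (hε : 0 < ε) :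
    {L | dH A K L < ε} ∈ 𝓝 K := by
  rw [nhds_hyperF]
  refine Filter.mem_iInf_of_mem A ?_
  let _ := pseudoMetric A
  have h := Metric.eball_mem_nhds K hε
  convert h using 1
  ext L
  exact (edist_comm K L ▸ Iff.rfl : edist K L < ε ↔ edist L K < ε)

theorem tendsto_hyperF {ι : Type*} {l : Filter ι} {f : ι → HyperF X} {K : HyperF X}
    (h : ∀ A, Filter.Tendsto (fun i => dH A (f i) K) l (𝓝 0)) : Filter.Tendsto f l (𝓝 K) := by
  rw [nhds_hyperF, Filter.tendsto_iInf]
  intro A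
  let _ := pseudoMetric A
  exact tendsto_iff_edist_tendsto_0.2 (h A)

theorem exists_of_dH_lt {A : X} {F G : HyperF X} {ε : ℝ}
    (h : dH A F G < ENNReal.ofReal ε) {σ : WeakDual ℝ X} (hσ : σ ∈ F.1) :
    ∃ τ ∈ G.1, |σ A - τ A| < ε := by
  have h1 : ⨅ τ ∈ G.1, ENNReal.ofReal |(σ - τ) A| < ENNReal.ofReal ε :=
    (le_iSup₂ (f := fun σ _ => ⨅ τ ∈ G.1, ENNReal.ofReal |(σ - τ) A|) σ hσ).trans_lt
      ((le_max_left _ _).trans_lt h)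
  simp only [iInf_lt_iff] at h1
  obtain ⟨τ, hτ, hlt⟩ := h1
  exact ⟨τ, hτ, (ENNReal.ofReal_lt_ofReal_iff_of_nonneg (abs_nonneg _)).1 hlt⟩

theorem dH_comm (A : X) (F G : HyperF X) : dH A F G = dH A G F := (pseudoMetric A).edist_comm F G

theorem dH_le {A : X} {F G : HyperF X} {ε : ℝ}
    (h1 : ∀ σ ∈ F.1, ∃ τ ∈ G.1, |σ A - τ A| ≤ ε) (h2 : ∀ τ ∈ G.1, ∃ σ ∈ F.1, |σ A - τ A| ≤ ε) :
    dH A F G ≤ ENNReal.ofReal ε := by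
  refine max_le (iSup₂_le fun σ hσ => ?_) (iSup₂_le fun τ hτ => ?_)
  · obtain ⟨τ, hτ, h⟩ := h1 σ hσ
    exact (iInf₂_le τ hτ).trans (ENNReal.ofReal_le_ofReal h)
  · obtain ⟨σ, hσ, h⟩ := h2 τ hτ
    exact (iInf₂_le σ hσ).trans (ENNReal.ofReal_le_ofReal h)

/-- Disjointness from a closed convex set is an open condition at compact convex sets. -/
theorem eventually_disjoint {K : HyperF X} (hK : IsCompact K.1) (hKc : Convex ℝ K.1)
    {F : Set (WeakDual ℝ X)} (hF : IsClosed F) (hFc : Convex ℝ F) (h : Disjoint K.1 F) :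
    ∀ᶠ L : HyperF X in 𝓝 K, Disjoint L.1 F := by
  obtain ⟨A, u, v, huv, hu, hv⟩ := exists_strict_separation hK hKc hF hFc h
  -- The radius is the separation gap, so no point of `L` can reach `F`.
  filter_upwards [dH_lt_mem_nhds K A (ENNReal.ofReal_pos.2 (sub_pos.2 huv))] with L hL
  replace hL := dH_comm A K L ▸ hL
  refine disjoint_left.2 fun τ hτ hτF => ?_
  obtain ⟨σ, hσ, hlt⟩ := exists_of_dH_lt hL hτ
  linarith [hu σ hσ, hv τ hτF, (abs_lt.1 hlt).2]

theorem eventually_exists_lt_apply {K : HyperF X} {A : X} {c : ℝ} (h : ∃ σ ∈ K.1, c < σ A) :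
    ∀ᶠ L : HyperF X in 𝓝 K, ∃ σ ∈ L.1, c < σ A := by
  obtain ⟨σ, hσ, hc⟩ := h
  filter_upwards [dH_lt_mem_nhds K A (ENNReal.ofReal_pos.2 (sub_pos.2 hc))] with L hL
  obtain ⟨τ, hτ, hlt⟩ := exists_of_dH_lt hL hσ
  exact ⟨τ, hτ, by linarith [(abs_lt.1 hlt).2]⟩

/-- A condition indexed by finitely many pairs of parallel hyperplanes: either `K` misses the smaller polyhedron, or `K` has a nonempty slice inside
the larger one. -/
def SliceCondition (x : ℕ → X) (s : Finset (ℕ × ℚ × ℚ)) (K : Set (WeakDual ℝ X)) : Prop :=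
  Disjoint K {σ | ∀ p ∈ s, σ (x p.1) ≤ p.2.1} ∨
    ∃ (A : X) (c : ℝ), (∃ σ ∈ K, c < σ A) ∧
      ∀ p ∈ s, Disjoint K {σ | c ≤ σ A ∧ (p.2.2 : ℝ) ≤ σ (x p.1)}

theorem isClosed_setOf_le_apply (A : X) (c : ℝ) : IsClosed {σ : WeakDual ℝ X | c ≤ σ A} :=
  isClosed_le continuous_const (WeakDual.eval_continuous A)

theorem convex_setOf_le_apply (A : X) (c : ℝ) : Convex ℝ {σ : WeakDual ℝ X | c ≤ σ A} :=
  convex_halfSpace_ge (evalCLM A).toLinearMap.isLinear c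

theorem eventually_sliceCondition {x : ℕ → X} {s : Finset (ℕ × ℚ × ℚ)} {K : HyperF X}
    (hK : IsCompact K.1) (hKc : Convex ℝ K.1) (h : SliceCondition x s K.1) :
    ∀ᶠ L : HyperF X in 𝓝 K, SliceCondition x s L.1 := by
  rcases h with h | ⟨A, c, hne, hdis⟩
  · refine (eventually_disjoint hK hKc ?_ ?_ h).mono fun L => Or.inl
    · simp only [ofPred_forall]
      exact isClosed_iInter fun p => isClosed_iInter fun _ =>
        isClosed_le (WeakDual.eval_continuous _) continuous_const
    · simp only [ofPred_forall]
      exact convex_iInter fun p => convex_iInter fun _ =>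
        convex_halfSpace_le (evalCLM (x p.1)).toLinearMap.isLinear _
  · have h1 := (Filter.eventually_all_finset s).2 fun p hp => eventually_disjoint hK hKc
      ((isClosed_setOf_le_apply A c).inter (isClosed_setOf_le_apply (x p.1) p.2.2))
      ((convex_setOf_le_apply A c).inter (convex_setOf_le_apply (x p.1) p.2.2)) (hdis p hp)
    filter_upwards [eventually_exists_lt_apply hne, h1] with L hL hL'
    exact Or.inr ⟨A, c, hL, hL'⟩

/-- A compact convex set has dense extreme boundary if and only if it satisfies all the slice
conditions. -/
theorem subset_closure_extremePoints_iff {x : ℕ → X} (hx : DenseRange x)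
    {K : Set (WeakDual ℝ X)} (hK : IsCompact K) (hKc : Convex ℝ K) :
    K ⊆ closure (K.extremePoints ℝ) ↔
      ∀ s : Finset (ℕ × ℚ × ℚ), (∀ p ∈ s, p.2.1 < p.2.2) → SliceCondition x s K := by
  constructor
  · intro h s hs
    by_cases hdis : Disjoint K {σ | ∀ p ∈ s, σ (x p.1) ≤ p.2.1}
    · exact Or.inl hdis
    obtain ⟨σ, hσK, hσ⟩ := not_disjoint_iff.1 hdis
    have hopen : IsOpen {τ : WeakDual ℝ X | ∀ p ∈ s, τ (x p.1) < p.2.2} := by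
      simp only [ofPred_forall]
      exact isOpen_biInter_finset fun p _ =>
        isOpen_lt (WeakDual.eval_continuous _) continuous_const
    obtain ⟨e, hes, he⟩ := mem_closure_iff.1 (h hσK) _ hopen fun p hp =>
      (hσ p hp).trans_lt (by exact_mod_cast hs p hp)
    obtain ⟨l, c, hlc, hc⟩ := exists_slice_of_mem_extremePoints hK hKc he s
      (P := fun p => {σ | (p.2.2 : ℝ) ≤ σ (x p.1)})
      (fun p _ => isClosed_setOf_le_apply _ _) (fun p _ => convex_setOf_le_apply _ _)
      (fun p hp h => (hes p hp).not_ge h)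
    obtain ⟨A, hA⟩ := exists_eq_eval l
    simp only [hA] at hlc hc
    exact Or.inr ⟨A, c, ⟨e, he.1, hlc⟩, fun p hp => disjoint_left.2 fun τ hτ hτ' =>
      hc τ hτ hτ'.1 p hp hτ'.2⟩
  · intro h σ hσ
    rw [mem_closure_iff]
    intro O hO hσO
    -- Finitely many strips will separate `σ` from all of `K \ O`. Then `σ` rules out the first
    -- alternative of the slice condition, and an extreme point in the slice from the second must
    -- lie in `O`.
    have hsep : ∀ τ ∈ K \ O, ∃ p : ℕ × ℚ × ℚ, p.2.1 < p.2.2 ∧ σ (x p.1) ≤ p.2.1 ∧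
        (p.2.2 : ℝ) < τ (x p.1) := by
      rintro τ ⟨-, hτO⟩
      have hne : ∃ A, σ A < τ A := by
        by_contra! hcon
        refine hτO ?_
        have : τ = σ := DFunLike.ext _ _ fun A =>
          le_antisymm (hcon A) (by have := hcon (-A); simpa using this)
        rwa [this]
      obtain ⟨n, hn⟩ := hx.exists_mem_open
        (isOpen_lt (map_continuous σ) (map_continuous τ)) hne
      obtain ⟨a, ha, haτ⟩ := exists_rat_btwn (show σ (x n) < τ (x n) from hn)
      obtain ⟨b, hb, hbτ⟩ := exists_rat_btwn haτ
      exact ⟨(n, a, b), by exact_mod_cast hb, ha.le, hbτ⟩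
    choose! p hp1 hp2 hp3 using hsep
    obtain ⟨t, htK, htc⟩ := (hK.diff hO).elim_nhds_subcover
      (fun τ => {ρ : WeakDual ℝ X | ((p τ).2.2 : ℝ) < ρ (x (p τ).1)})
      (fun τ hτ => (isOpen_lt continuous_const (WeakDual.eval_continuous _)).mem_nhds (hp3 τ hτ))
    classical
    rcases h (t.image p) (by simpa using fun τ hτ => hp1 τ (htK τ hτ)) with hd | ⟨A, c, hne, hd⟩
    · refine (disjoint_left.1 hd hσ ?_).elim
      simpa using fun τ hτ => hp2 τ (htK τ hτ)
    · obtain ⟨e, he, hce⟩ := exists_extremePoint_mem_slice hK (evalCLM A) hne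
      refine ⟨e, ?_, he⟩
      by_contra heO
      obtain ⟨τ, hτ, heτ⟩ := mem_iUnion₂.1 (htc ⟨he.1, heO⟩)
      exact disjoint_left.1 (hd (p τ) (Finset.mem_image_of_mem _ hτ)) he.1
        ⟨le_of_lt hce, le_of_lt heτ⟩

end Hyperspace

end WeakStarHyper

namespace WeakStarHyper

/-! ### Positive functionals and order intervals in the dual -/

section PositiveFunctionals

variable {X : Type*} [AddCommGroup X] [Module ℝ X] [TopologicalSpace X] {C : ConvexCone ℝ X}

theorem isClosed_posDual (C : ConvexCone ℝ X) : IsClosed (posDual C) := by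
  simp only [posDual, ofPred_forall]
  exact isClosed_iInter fun A => isClosed_iInter fun _ => isClosed_setOf_le_apply A 0

theorem zero_mem_posDual (C : ConvexCone ℝ X) : (0 : WeakDual ℝ X) ∈ posDual C :=
  fun _ _ => le_rfl

theorem add_mem_posDual {σ τ : WeakDual ℝ X} (hσ : σ ∈ posDual C) (hτ : τ ∈ posDual C) :
    σ + τ ∈ posDual C := fun A hA => add_nonneg (hσ A hA) (hτ A hA)

theorem smul_mem_posDual {σ : WeakDual ℝ X} {r : ℝ} (hr : 0 ≤ r) (hσ : σ ∈ posDual C) :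
    r • σ ∈ posDual C := fun A hA => mul_nonneg hr (hσ A hA)

theorem sum_mem_posDual {ι : Type*} {s : Finset ι} {f : ι → WeakDual ℝ X}
    (h : ∀ i ∈ s, f i ∈ posDual C) : ∑ i ∈ s, f i ∈ posDual C :=
  Finset.sum_induction f (· ∈ posDual C) (fun _ _ => add_mem_posDual) (zero_mem_posDual C) h

theorem convex_posDual (C : ConvexCone ℝ X) : Convex ℝ (posDual C) :=
  fun _ hσ _ hτ _ _ ha hb _ => add_mem_posDual (smul_mem_posDual ha hσ) (smul_mem_posDual hb hτ)

theorem sub_mem_posDual_of_finset_sum {ι : Type*} [DecidableEq ι] {s : Finset ι}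
    {f : ι → WeakDual ℝ X} (h : ∀ i ∈ s, f i ∈ posDual C) {k : ι} (hk : k ∈ s) :
    ∑ i ∈ s, f i - f k ∈ posDual C := by
  rw [← Finset.sum_erase_eq_sub hk]
  exact sum_mem_posDual fun i hi => h i (Finset.mem_of_mem_erase hi)

variable {A₁ A₂ : X} {V : Set X}

/-- Both $0$ and $A$ lie in the interval, so $\sigma(A)$ and $0$ lie in $[\sigma(A_1),\sigma(A_2)]$.
A single evaluation thus controls a positive functional on all of `V`. -/
theorem abs_apply_le_of_mem_posDual (hV0 : (0 : X) ∈ V) (hV : V ⊆ orderInterval C A₁ A₂)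
    {σ : WeakDual ℝ X} (hσ : σ ∈ posDual C) {A : X} (hA : A ∈ V) : |σ A| ≤ σ (A₂ - A₁) := by
  have h1 := hσ _ (hV hA).1
  have h2 := hσ _ (hV hA).2
  have h3 := hσ _ (hV hV0).1
  have h4 := hσ _ (hV hV0).2
  simp only [map_sub, map_zero] at *
  exact abs_le.2 ⟨by linarith, by linarith⟩

theorem subset_absPolar_of_forall_le {K : Set (WeakDual ℝ X)} {c : ℝ} (hc : 0 < c)
    (h : ∀ σ ∈ K, ∀ A ∈ V, |σ A| ≤ c) : K ⊆ absPolar {A | c • A ∈ V} := by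
  intro σ hσ A hA
  have := h σ hσ _ hA
  rw [map_smul, smul_eq_mul, abs_mul, abs_of_pos hc] at this
  exact le_of_mul_le_mul_left (by rwa [mul_one]) hc

variable [ContinuousSMul ℝ X]

theorem smul_preimage_mem_nhds_zero (hV : V ∈ 𝓝 (0 : X)) (c : ℝ) : {A | c • A ∈ V} ∈ 𝓝 (0 : X) :=
  (continuous_const_smul c).continuousAt.preimage_mem_nhds (by rwa [smul_zero])

theorem exists_pos_smul_mem (hV : V ∈ 𝓝 (0 : X)) (A : X) :
    ∀ᶠ c : ℝ in 𝓝[>] 0, c • A ∈ V := by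
  have hc : ContinuousAt (fun c : ℝ => c • A) 0 := by fun_prop
  exact (hc.eventually (by simpa using hV)).filter_mono nhdsWithin_le_nhds

/-- Compact sets of positive functionals are equicontinuous. -/
theorem exists_subset_absPolar (hV0 : V ∈ 𝓝 (0 : X)) (hV : V ⊆ orderInterval C A₁ A₂)
    {K : Set (WeakDual ℝ X)} (hK : IsCompact K) (hKC : K ⊆ posDual C) :
    ∃ U ∈ 𝓝 (0 : X), K ⊆ absPolar U := by
  obtain ⟨M, hM0, hM⟩ := exists_forall_abs_apply_le hK (A₂ - A₁)
  refine ⟨_, smul_preimage_mem_nhds_zero hV0 (M + 1), subset_absPolar_of_forall_le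
    (by positivity) fun σ hσ A hA => ?_⟩
  linarith [abs_apply_le_of_mem_posDual (mem_of_mem_nhds hV0) hV (hKC hσ) hA, hM σ hσ,
    le_abs_self (σ (A₂ - A₁))]

theorem isCompact_posDual_inter_le [IsTopologicalAddGroup X] (hV0 : V ∈ 𝓝 (0 : X))
    (hV : V ⊆ orderInterval C A₁ A₂) (c : ℝ) :
    IsCompact (posDual C ∩ {σ | σ (A₂ - A₁) ≤ c}) := by
  refine (isCompact_absPolar (smul_preimage_mem_nhds_zero hV0 (|c| + 1))).of_isClosed_subset
    ((isClosed_posDual C).inter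
      (isClosed_le (WeakDual.eval_continuous _) continuous_const))
    (subset_absPolar_of_forall_le (by positivity) fun σ hσ A hA => ?_)
  have hle : σ (A₂ - A₁) ≤ c := hσ.2
  linarith [abs_apply_le_of_mem_posDual (mem_of_mem_nhds hV0) hV hσ.1 hA, le_abs_self c]

/-- The order interval `[-φ, φ]` in the dual space. -/
def dualInterval (C : ConvexCone ℝ X) (φ : WeakDual ℝ X) : Set (WeakDual ℝ X) :=
  {σ | φ + σ ∈ posDual C ∧ φ - σ ∈ posDual C}

omit [ContinuousSMul ℝ X] in
theorem convex_dualInterval (C : ConvexCone ℝ X) (φ : WeakDual ℝ X) :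
    Convex ℝ (dualInterval C φ) := by
  rintro σ ⟨h1, h2⟩ τ ⟨h3, h4⟩ a b ha hb hab
  constructor
  · convert convex_posDual C h1 h3 ha hb hab using 1
    rw [smul_add, smul_add, add_add_add_comm, ← add_smul, hab, one_smul]
  · convert convex_posDual C h2 h4 ha hb hab using 1
    rw [smul_sub, smul_sub, sub_add_sub_comm, ← add_smul, hab, one_smul]

theorem isCompact_dualInterval [IsTopologicalAddGroup X] (hV0 : V ∈ 𝓝 (0 : X))
    (hV : V ⊆ orderInterval C A₁ A₂) (φ : WeakDual ℝ X) : IsCompact (dualInterval C φ) := by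
  have he : A₂ - A₁ ∈ C := by
    have h0 := hV (mem_of_mem_nhds hV0)
    have := C.add_mem h0.1 h0.2
    simpa [sub_eq_add_neg, add_comm] using this
  have hcl : IsClosed (dualInterval C φ) :=
    ((isClosed_posDual C).preimage (by fun_prop : Continuous fun σ => φ + σ)).inter
      ((isClosed_posDual C).preimage (by fun_prop : Continuous fun σ => φ - σ))
  -- Adding `φ` moves the interval into the positive functionals with value at most
  -- $2\varphi(A_2-A_1)$ at $A_2-A_1$.
  have hcpt := (isCompact_posDual_inter_le hV0 hV (2 * φ (A₂ - A₁))).image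
    (by fun_prop : Continuous fun σ => σ - φ)
  refine hcpt.of_isClosed_subset hcl fun σ hσ => ⟨φ + σ, ⟨hσ.1, ?_⟩, add_sub_cancel_left _ _⟩
  have h : 0 ≤ φ (A₂ - A₁) - σ (A₂ - A₁) := hσ.2 _ he
  change φ (A₂ - A₁) + σ (A₂ - A₁) ≤ 2 * φ (A₂ - A₁)
  linarith

end PositiveFunctionals

/-! ### Infinitely many positive functionals and a common majorant -/

section Absorption

variable {X : Type*} [AddCommGroup X] [Module ℝ X] [TopologicalSpace X]
  [IsTopologicalAddGroup X] [ContinuousSMul ℝ X] {C : ConvexCone ℝ X} {A₁ A₂ : X} {V : Set X}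

omit [IsTopologicalAddGroup X] in
/-- Order intervals contained in arbitrarily small neighbourhoods are bounded. -/
theorem exists_pos_smul_orderInterval_subset
    (hC : ∀ U ∈ 𝓝 (0 : X), ∃ A₁ A₂ : X, ∃ V ∈ 𝓝 (0 : X),
      V ⊆ orderInterval C A₁ A₂ ∧ orderInterval C A₁ A₂ ⊆ U) (A₁ A₂ : X) {U : Set X}
    (hU : U ∈ 𝓝 (0 : X)) : ∃ t : ℝ, 0 < t ∧ ∀ A ∈ orderInterval C A₁ A₂, t • A ∈ U := by
  obtain ⟨B₁, B₂, V, hV0, hV, hVU⟩ := hC U hU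
  obtain ⟨t, ⟨h1, h2⟩, ht⟩ := (((exists_pos_smul_mem hV0 A₁).and (exists_pos_smul_mem hV0 A₂)).and
    (self_mem_nhdsWithin : Ioi (0 : ℝ) ∈ 𝓝[>] 0)).exists
  have ht : 0 < t := ht
  refine ⟨t, ht, fun A hA => hVU ⟨?_, ?_⟩⟩
  · convert C.add_mem (C.smul_mem ht hA.1) (hV h1).1 using 1
    rw [smul_sub, sub_add_sub_cancel]
  · convert C.add_mem (C.smul_mem ht hA.2) (hV h2).2 using 1
    rw [smul_sub, add_comm, sub_add_sub_cancel]

omit [IsTopologicalAddGroup X] in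
theorem exists_forall_orderInterval_abs_le
    (hC : ∀ U ∈ 𝓝 (0 : X), ∃ A₁ A₂ : X, ∃ V ∈ 𝓝 (0 : X),
      V ⊆ orderInterval C A₁ A₂ ∧ orderInterval C A₁ A₂ ⊆ U) (A₁ A₂ : X) (σ : WeakDual ℝ X) :
    ∃ M, ∀ A ∈ orderInterval C A₁ A₂, |σ A| ≤ M := by
  have hU : {A : X | |σ A| < 1} ∈ 𝓝 (0 : X) :=
    (isOpen_lt (map_continuous σ).abs continuous_const).mem_nhds (by simp)
  obtain ⟨t, ht, h⟩ := exists_pos_smul_orderInterval_subset hC A₁ A₂ hU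
  refine ⟨t⁻¹, fun A hA => ?_⟩
  have := h A hA
  simp only [mem_ofPred_eq, map_smul, smul_eq_mul, abs_mul, abs_of_pos ht] at this
  rw [← mul_one t⁻¹, le_inv_mul_iff₀ ht]
  exact this.le

/-- An interior point of a convex cone remains in the cone when it is translated by a vector
on which all continuous positive functionals vanish. -/
theorem add_mem_of_forall_posDual_eq_zero {B : X} (hB : (C : Set X) ∈ 𝓝 B) {A : X}
    (hA : ∀ σ ∈ posDual C, σ A = 0) : B + A ∈ C := by
  by_contra hcon
  obtain ⟨f, hf⟩ := geometric_hahn_banach_point_open C.convex.interior isOpen_interior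
    (fun h => hcon (interior_subset h))
  have hBi : B ∈ interior (C : Set X) := mem_interior_iff_mem_nhds.2 hB
  have hadd : ∀ c ∈ C, B + c ∈ interior (C : Set X) := by
    intro c hc
    have hsub : (fun x => x + c) '' interior (C : Set X) ⊆ interior (C : Set X) := by
      refine interior_maximal ?_ ((Homeomorph.addRight c).isOpenMap _ isOpen_interior)
      rintro _ ⟨x, hx, rfl⟩
      exact C.add_mem (interior_subset hx) hc
    exact hsub (mem_image_of_mem _ hBi)
  have hpos : StrongDual.toWeakDual f ∈ posDual C := by
    intro c hc
    by_contra! hneg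
    have hneg : f c < 0 := hneg
    obtain ⟨n, hn⟩ := exists_nat_gt (f A / f c)
    -- The cone need not contain `0`, so only positive multiples of `c` may be added to `B`.
    rcases n.eq_zero_or_pos with rfl | hn0
    · have h0 := hf _ hBi
      rw [map_add] at h0
      have : f A / f c > 0 := div_pos_of_neg_of_neg (by linarith) hneg
      norm_num at hn
      linarith
    · have h := hf _ (hadd _ (C.smul_mem (Nat.cast_pos.2 hn0 : (0 : ℝ) < n) hc))
      rw [map_add, map_add, map_smul, smul_eq_mul] at h
      rw [div_lt_iff_of_neg hneg] at hn
      linarith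
  have h0 := hf _ hBi
  have hA0 : f A = 0 := hA _ hpos
  rw [map_add, hA0] at h0
  linarith

/-- Continuous positive functionals separate points. -/
theorem eq_zero_of_forall_posDual [T2Space X]
    (hC : ∀ U ∈ 𝓝 (0 : X), ∃ A₁ A₂ : X, ∃ V ∈ 𝓝 (0 : X),
      V ⊆ orderInterval C A₁ A₂ ∧ orderInterval C A₁ A₂ ⊆ U) {A : X}
    (hA : ∀ σ ∈ posDual C, σ A = 0) : A = 0 := by
  by_contra hne
  -- `-A₁` and `A₂` are interior to the cone, so translation by `±A` keeps them in it. This puts `A`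
  -- in an interval that avoids `A`.
  obtain ⟨A₁, A₂, V, hV0, hV, hVU⟩ := hC {A}ᶜ (isOpen_compl_singleton.mem_nhds (Ne.symm hne))
  have h1 : (C : Set X) ∈ 𝓝 (-A₁) := by
    have hc : ContinuousAt (fun B : X => B + A₁) (-A₁) := by fun_prop
    filter_upwards [hc.preimage_mem_nhds (by simpa using hV0)] with B hB
    simpa using (hV hB).1
  have h2 : (C : Set X) ∈ 𝓝 A₂ := by
    have hc : ContinuousAt (fun B : X => A₂ - B) A₂ := by fun_prop
    filter_upwards [hc.preimage_mem_nhds (by simpa using hV0)] with B hB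
    simpa using (hV hB).2
  refine hVU ⟨?_, ?_⟩ (mem_singleton A)
  · simpa [sub_eq_add_neg, add_comm] using add_mem_of_forall_posDual_eq_zero h1 hA
  · rw [sub_eq_add_neg]
    exact add_mem_of_forall_posDual_eq_zero h2 (A := -A) fun σ hσ => by
      rw [map_neg, hA σ hσ, neg_zero]

/-- There are infinitely many linearly independent continuous positive functionals. -/
theorem exists_linearIndependent_posDual [T2Space X]
    (hC : ∀ U ∈ 𝓝 (0 : X), ∃ A₁ A₂ : X, ∃ V ∈ 𝓝 (0 : X),
      V ⊆ orderInterval C A₁ A₂ ∧ orderInterval C A₁ A₂ ⊆ U)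
    {ρ : ℕ → WeakDual ℝ X} (hρ : LinearIndependent ℝ ρ) :
    ∃ τ : ℕ → WeakDual ℝ X, LinearIndependent ℝ τ ∧ ∀ n, τ n ∈ posDual C := by
  obtain ⟨b, hb, hspan, hli⟩ := exists_linearIndependent ℝ (posDual C)
  -- If the positive functionals spanned a finite-dimensional space, point separation would embed
  -- `X` in its dual, contradicting the independence of `ρ`.
  rcases b.finite_or_infinite with hfin | hinf
  · exfalso
    let W := Submodule.span ℝ b
    have : Module.Finite ℝ W := Module.Finite.span_of_finite ℝ hfin
    let g : X →ₗ[ℝ] Module.Dual ℝ W :=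
      { toFun := fun A =>
          { toFun := fun w => (w : WeakDual ℝ X) A
            map_add' := fun _ _ => rfl
            map_smul' := fun _ _ => rfl }
        map_add' := fun A B => LinearMap.ext fun w => map_add (w : WeakDual ℝ X) A B
        map_smul' := fun r A => LinearMap.ext fun w => map_smul (w : WeakDual ℝ X) r A }
    have hg : Function.Injective g := by
      refine (injective_iff_map_eq_zero g).2 fun A hA => eq_zero_of_forall_posDual hC fun σ hσ => ?_
      have hσW : σ ∈ W := hspan.ge (Submodule.subset_span hσ)
      exact LinearMap.congr_fun hA ⟨σ, hσW⟩
    have : Module.Finite ℝ X := Module.Finite.of_injective g hg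
    have hind : LinearIndependent ℝ fun n => topDualPairing ℝ X (ρ n) :=
      hρ.map' (topDualPairing ℝ X) (LinearMap.ker_eq_bot.2 ContinuousLinearMap.coe_injective)
    exact not_finite_iff_infinite.2 inferInstance hind.finite
  · have := hinf.to_subtype
    exact ⟨fun n => Infinite.natEmbedding b n, hli.comp _ (Infinite.natEmbedding b).injective,
      fun n => hb (Infinite.natEmbedding b n).2⟩

/-- A sequence of positive functionals is dominated, up to positive scalars, by a single positive
functional. -/
theorem exists_dominating_posDual (hV0 : V ∈ 𝓝 (0 : X)) (hV : V ⊆ orderInterval C A₁ A₂)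
    {τ : ℕ → WeakDual ℝ X} (hτ : ∀ n, τ n ∈ posDual C) :
    ∃ φ ∈ posDual C, ∀ n, ∃ r : ℝ, 0 < r ∧ φ - r • τ n ∈ posDual C := by
  set e := A₂ - A₁ with he
  have hτe : ∀ n, 0 ≤ τ n e := fun n =>
    (abs_nonneg _).trans (abs_apply_le_of_mem_posDual (mem_of_mem_nhds hV0) hV (hτ n)
      (mem_of_mem_nhds hV0))
  -- This scaling gives $r_n\tau_n(e)\le 2^{-n}$, so all partial sums lie in the compact set
  -- $\{\sigma\ge0,\ \sigma(e)\le2\}$. A nested intersection then supplies `φ` without summing a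
  -- series.
  let r : ℕ → ℝ := fun n => (1 / 2) ^ n / (1 + τ n e)
  have hr : ∀ n, 0 < r n := fun n => div_pos (by positivity) (by linarith [hτe n])
  have hpos : ∀ n, r n • τ n ∈ posDual C := fun n => smul_mem_posDual (hr n).le (hτ n)
  let t : ℕ → Set (WeakDual ℝ X) := fun n =>
    (posDual C ∩ {σ | σ e ≤ 2}) ∩ ⋂ k ∈ Finset.range n, {σ | σ - r k • τ k ∈ posDual C}
  have hcl : ∀ n, IsClosed (⋂ k ∈ Finset.range n, {σ | σ - r k • τ k ∈ posDual C}) := fun n =>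
    isClosed_biInter fun k _ => (isClosed_posDual C).preimage
      (by fun_prop : Continuous fun σ => σ - r k • τ k)
  have hcpt : ∀ n, IsCompact (t n) := fun n =>
    (isCompact_posDual_inter_le hV0 hV 2).inter_right (hcl n)
  have hne : ∀ n, (t n).Nonempty := by
    intro n
    refine ⟨∑ k ∈ Finset.range n, r k • τ k, ⟨sum_mem_posDual fun k _ => hpos k, ?_⟩, ?_⟩
    · have h1 : (∑ k ∈ Finset.range n, r k • τ k) e = ∑ k ∈ Finset.range n, r k * τ k e := by
        have := map_sum (evalCLM e) (fun k => r k • τ k) (Finset.range n)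
        exact this
      change (∑ k ∈ Finset.range n, r k • τ k) e ≤ 2
      rw [h1]
      calc ∑ k ∈ Finset.range n, r k * τ k e ≤ ∑ k ∈ Finset.range n, (1 / 2 : ℝ) ^ k := by
            refine Finset.sum_le_sum fun k _ => ?_
            have h0 := hτe k
            change (1 / 2 : ℝ) ^ k / (1 + τ k e) * τ k e ≤ _
            rw [div_mul_eq_mul_div, div_le_iff₀ (by linarith)]
            exact mul_le_mul_of_nonneg_left (by linarith) (by positivity)
        _ ≤ 2 := sum_geometric_two_le n
    · simp only [mem_iInter]
      exact fun k hk => sub_mem_posDual_of_finset_sum (fun k _ => hpos k) hk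
  obtain ⟨φ, hφ⟩ := IsCompact.nonempty_iInter_of_sequence_nonempty_isCompact_isClosed t
    (fun n => inter_subset_inter_right _ (biInter_subset_biInter_left fun k hk => by
      simp only [Finset.coe_range, mem_Iio] at hk ⊢; omega)) hne (hcpt 0)
    (fun n => (hcpt n).isClosed)
  rw [mem_iInter] at hφ
  refine ⟨φ, (hφ 0).1.1, fun n => ⟨r n, hr n, ?_⟩⟩
  exact mem_iInter₂.1 (hφ (n + 1)).2 n (Finset.self_mem_range_succ n)

omit [IsTopologicalAddGroup X] [ContinuousSMul ℝ X] in
/-- The functionals `v` with `-M φ ≤ v ≤ M φ` for some `M` form a subspace. -/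
theorem exists_dominated_of_mem_span {φ : WeakDual ℝ X} (hφ : φ ∈ posDual C)
    {τ : ℕ → WeakDual ℝ X} (hτ : ∀ n, τ n ∈ posDual C)
    (hdom : ∀ n, ∃ r : ℝ, 0 < r ∧ φ - r • τ n ∈ posDual C) {v : WeakDual ℝ X}
    (hv : v ∈ Submodule.span ℝ (range τ)) :
    ∃ M : ℝ, 0 ≤ M ∧ M • φ + v ∈ posDual C ∧ M • φ - v ∈ posDual C := by
  induction hv using Submodule.span_induction with
  | mem v hv =>
    obtain ⟨n, rfl⟩ := hv
    obtain ⟨r, hr, h⟩ := hdom n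
    refine ⟨r⁻¹, by positivity, add_mem_posDual (smul_mem_posDual (by positivity) hφ) (hτ n), ?_⟩
    convert smul_mem_posDual (inv_nonneg.2 hr.le) h using 1
    rw [smul_sub, inv_smul_smul₀ hr.ne']
  | zero => exact ⟨0, le_rfl, by simpa using zero_mem_posDual C, by simpa using zero_mem_posDual C⟩
  | add v w _ _ hv hw =>
    obtain ⟨M, hM, h1, h2⟩ := hv
    obtain ⟨N, hN, h3, h4⟩ := hw
    refine ⟨M + N, by positivity, ?_, ?_⟩
    · convert add_mem_posDual h1 h3 using 1; rw [add_smul]; abel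
    · convert add_mem_posDual h2 h4 using 1; rw [add_smul]; abel
  | smul c v _ hv =>
    obtain ⟨M, hM, h1, h2⟩ := hv
    refine ⟨|c| * M, by positivity, ?_⟩
    rcases le_total 0 c with hc | hc
    · rw [abs_of_nonneg hc, mul_smul, ← smul_add, ← smul_sub]
      exact ⟨smul_mem_posDual hc h1, smul_mem_posDual hc h2⟩
    · have h1' := smul_mem_posDual (neg_nonneg.2 hc) h1
      have h2' := smul_mem_posDual (neg_nonneg.2 hc) h2
      rw [smul_sub, smul_smul, neg_smul c v, sub_neg_eq_add] at h2'
      rw [smul_add, smul_smul, neg_smul c v, ← sub_eq_add_neg] at h1'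
      rw [abs_of_nonpos hc]
      exact ⟨h2', h1'⟩

omit [IsTopologicalAddGroup X] [ContinuousSMul ℝ X] in
theorem exists_finite_annihilator_subset {O : Set (WeakDual ℝ X)} (hO : O ∈ 𝓝 0) :
    ∃ I : Set X, I.Finite ∧ ∀ σ : WeakDual ℝ X, (∀ A ∈ I, σ A = 0) → σ ∈ O := by
  have hemb : IsEmbedding (fun (σ : WeakDual ℝ X) (A : X) => σ A) :=
    WeakBilin.isEmbedding ContinuousLinearMap.coe_injective
  rw [hemb.nhds_eq_comap, Filter.mem_comap] at hO
  obtain ⟨t, ht, htO⟩ := hO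
  rw [nhds_pi, Filter.mem_pi] at ht
  obtain ⟨I, hI, u, hu, hut⟩ := ht
  refine ⟨I, hI, fun σ hσ => htO (hut fun A hA => ?_)⟩
  have := mem_of_mem_nhds (hu A)
  simpa [hσ A hA] using! this

-- A weak* neighbourhood of `0` constrains only finitely many evaluations, and some nonzero
-- combination of the infinitely many `τ n` annihilates them all.
omit [IsTopologicalAddGroup X] [ContinuousSMul ℝ X] in
theorem exists_ne_zero_mem_span_of_nhds {τ : ℕ → WeakDual ℝ X} (hτ : LinearIndependent ℝ τ)
    {O : Set (WeakDual ℝ X)} (hO : O ∈ 𝓝 0) :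
    ∃ v ∈ Submodule.span ℝ (range τ), v ≠ 0 ∧ ∀ s : ℝ, s • v ∈ O := by
  obtain ⟨I, hI, h⟩ := exists_finite_annihilator_subset hO
  have := hI.to_subtype
  let g : (ℕ →₀ ℝ) →ₗ[ℝ] (I → ℝ) :=
    LinearMap.pi fun A => (evalCLM (A : X)).toLinearMap ∘ₗ Finsupp.linearCombination ℝ τ
  have hg : ¬ Function.Injective g := by
    intro hinj
    have : Module.Finite ℝ (ℕ →₀ ℝ) := Module.Finite.of_injective g hinj
    exact not_finite_iff_infinite.2 inferInstance
      (Finsupp.basisSingleOne (R := ℝ) (ι := ℕ)).linearIndependent.finite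
  rw [injective_iff_map_eq_zero] at hg
  push Not at hg
  obtain ⟨c, hc, hc0⟩ := hg
  refine ⟨Finsupp.linearCombination ℝ τ c, Finsupp.mem_span_range_iff_exists_finsupp.2 ⟨c, rfl⟩, ?_,
    fun s => h _ fun A hA => ?_⟩
  · exact fun h0 => hc0 (hτ (by rw [h0, map_zero]))
  · have h0 : (Finsupp.linearCombination ℝ τ c) A = 0 := congrFun hc ⟨A, hA⟩
    change s * (Finsupp.linearCombination ℝ τ c) A = 0
    rw [h0, mul_zero]

end Absorption

end WeakStarHyper

namespace WeakStarHyper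

/-! ### A strictly convex function, continuous on bounded sets -/

section StrictlyConvex

variable {X : Type*} [AddCommGroup X] [Module ℝ X] [TopologicalSpace X]

/-- The quadratic functional `σ ↦ ∑ₙ 2⁻ⁿ σ(yₙ)²`. -/
noncomputable def quadSum (y : ℕ → X) (σ : WeakDual ℝ X) : ℝ := ∑' n, (1 / 2 : ℝ) ^ n * σ (y n) ^ 2

variable {y : ℕ → X}

theorem quadSum_nonneg (σ : WeakDual ℝ X) : 0 ≤ quadSum y σ :=
  tsum_nonneg fun n => by positivity

theorem quadSum_term_le {σ : WeakDual ℝ X} {M : ℝ} (h : ∀ n, |σ (y n)| ≤ M) (n : ℕ) :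
    (1 / 2 : ℝ) ^ n * σ (y n) ^ 2 ≤ (1 / 2 : ℝ) ^ n * M ^ 2 :=
  mul_le_mul_of_nonneg_left (sq_le_sq' (abs_le.1 (h n)).1 (abs_le.1 (h n)).2) (by positivity)

theorem summable_quadSum {σ : WeakDual ℝ X} {M : ℝ} (h : ∀ n, |σ (y n)| ≤ M) :
    Summable fun n => (1 / 2 : ℝ) ^ n * σ (y n) ^ 2 :=
  Summable.of_nonneg_of_le (fun n => by positivity) (quadSum_term_le h)
    (summable_geometric_two.mul_right _)

theorem quadSum_le {σ : WeakDual ℝ X} {M : ℝ} (h : ∀ n, |σ (y n)| ≤ M) :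
    quadSum y σ ≤ 2 * M ^ 2 := by
  rw [← tsum_geometric_two, ← tsum_mul_right]
  exact (summable_quadSum h).tsum_le_tsum (quadSum_term_le h) (summable_geometric_two.mul_right _)

theorem continuousOn_quadSum (M : ℝ) :
    ContinuousOn (quadSum y) {σ | ∀ n, |σ (y n)| ≤ M} := by
  refine continuousOn_tsum (u := fun n => (1 / 2 : ℝ) ^ n * M ^ 2)
    (fun n => ((WeakDual.eval_continuous (y n)).pow 2).const_mul _ |>.continuousOn)
    (summable_geometric_two.mul_right _) fun n σ hσ => ?_
  rw [Real.norm_of_nonneg (by positivity)]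
  exact quadSum_term_le hσ n

theorem strictConvexOn_quadSum (hbdd : ∀ σ : WeakDual ℝ X, ∃ M, ∀ n, |σ (y n)| ≤ M)
    (hsep : ∀ σ : WeakDual ℝ X, (∀ n, σ (y n) = 0) → σ = 0) :
    StrictConvexOn ℝ univ (quadSum y) := by
  have hsum : ∀ σ : WeakDual ℝ X, Summable fun n => (1 / 2 : ℝ) ^ n * σ (y n) ^ 2 := fun σ =>
    summable_quadSum (hbdd σ).choose_spec
  refine ⟨convex_univ, fun σ _ τ _ hne a b ha hb hab => ?_⟩
  obtain ⟨i, hi⟩ : ∃ n, (σ - τ) (y n) ≠ 0 := by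
    by_contra! hcon
    exact hne (sub_eq_zero.1 (hsep _ hcon))
  have hi : σ (y i) - τ (y i) ≠ 0 := hi
  -- For $a+b=1$, $au^2+bv^2-(au+bv)^2=ab(u-v)^2$; strictness comes from one separating index.
  have hkey : ∀ n, a * ((1 / 2 : ℝ) ^ n * σ (y n) ^ 2) + b * ((1 / 2 : ℝ) ^ n * τ (y n) ^ 2) -
      (1 / 2 : ℝ) ^ n * ((a • σ + b • τ) (y n)) ^ 2 =
      (1 / 2 : ℝ) ^ n * (a * b * (σ (y n) - τ (y n)) ^ 2) := by
    intro n
    change a * ((1 / 2 : ℝ) ^ n * σ (y n) ^ 2) + b * ((1 / 2 : ℝ) ^ n * τ (y n) ^ 2) -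
      (1 / 2 : ℝ) ^ n * (a * σ (y n) + b * τ (y n)) ^ 2 = _
    obtain rfl : b = 1 - a := by linarith
    ring
  simp only [smul_eq_mul, quadSum, ← tsum_mul_left]
  rw [← ((hsum σ).mul_left a).tsum_add ((hsum τ).mul_left b)]
  refine Summable.tsum_lt_tsum (i := i) (fun n => ?_) ?_ (hsum _)
    (((hsum σ).mul_left a).add ((hsum τ).mul_left b))
  · rw [← sub_nonneg, hkey]
    positivity
  · rw [← sub_pos, hkey]
    positivity

/-- In a separable space, every neighbourhood of `0` contains a sequence that separates continuous
functionals. -/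
theorem exists_separating_seq [ContinuousSMul ℝ X] [TopologicalSpace.SeparableSpace X] {V : Set X}
    (hV : V ∈ 𝓝 (0 : X)) : ∃ y : ℕ → X, (∀ n, y n ∈ V) ∧
      ∀ σ : WeakDual ℝ X, (∀ n, σ (y n) = 0) → σ = 0 := by
  have : Nonempty X := ⟨0⟩
  have h : ∀ n, ∃ c : ℝ, c • TopologicalSpace.denseSeq X n ∈ V ∧ c ≠ 0 := fun n => by
    obtain ⟨c, hc, hc0⟩ := ((exists_pos_smul_mem hV (TopologicalSpace.denseSeq X n)).and
      (self_mem_nhdsWithin : Ioi (0 : ℝ) ∈ 𝓝[>] 0)).exists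
    exact ⟨c, hc, ne_of_gt hc0⟩
  choose c hc hc0 using h
  refine ⟨fun n => c n • TopologicalSpace.denseSeq X n, hc, fun σ hσ => ?_⟩
  have heq : (σ : X → ℝ) = fun _ => 0 := by
    refine (TopologicalSpace.denseRange_denseSeq X).equalizer (map_continuous σ) continuous_const (funext fun n => ?_)
    have := hσ n
    rw [map_smul, smul_eq_mul] at this
    exact (mul_eq_zero.1 this).resolve_left (hc0 n)
  exact DFunLike.ext _ _ fun A => congrFun heq A

end StrictlyConvex

/-! ### Approximation by sets with dense extreme points -/

section Approximation

variable {X : Type*} [AddCommGroup X] [Module ℝ X] [TopologicalSpace X]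
  [IsTopologicalAddGroup X] [ContinuousSMul ℝ X] {C : ConvexCone ℝ X} {A₁ A₂ : X} {V : Set X}

theorem isCompact_of_mem_CUpos {K : HyperF X} (hK : K ∈ CUpos C) : IsCompact K.1 := by
  obtain ⟨U, hU, hKU⟩ := mem_iUnion₂.1 hK
  exact (isCompact_absPolar hU).of_isClosed_subset K.2.2 hKU.1.2

omit [IsTopologicalAddGroup X] [ContinuousSMul ℝ X] in
theorem convex_of_mem_CUpos {K : HyperF X} (hK : K ∈ CUpos C) : Convex ℝ K.1 := by
  obtain ⟨U, hU, hKU⟩ := mem_iUnion₂.1 hK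
  exact hKU.1.1

omit [IsTopologicalAddGroup X] [ContinuousSMul ℝ X] in
theorem subset_posDual_of_mem_CUpos {K : HyperF X} (hK : K ∈ CUpos C) : K.1 ⊆ posDual C := by
  obtain ⟨U, hU, hKU⟩ := mem_iUnion₂.1 hK
  exact hKU.2

omit [IsTopologicalAddGroup X] [ContinuousSMul ℝ X] in
theorem mem_Dpos_iff {K : HyperF X} (hK : K ∈ CUpos C) :
    K ∈ Dpos C ↔ K.1 ⊆ closure (K.1.extremePoints ℝ) := by
  refine ⟨fun h => ?_, fun h => ⟨?_, hK⟩⟩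
  · obtain ⟨U, hU, hKU⟩ := mem_iUnion₂.1 h.1
    exact hKU.2.subset
  · obtain ⟨U, hU, hKU⟩ := mem_iUnion₂.1 hK
    exact mem_iUnion₂.2 ⟨U, hU, hKU.1,
      h.antisymm (closure_minimal extremePoints_subset K.2.2)⟩

/-- Every compact convex set of positive functionals is approximated, at a rate that is linear for
each pseudometric, by compact convex sets of positive functionals with dense extreme boundary. -/
theorem exists_mem_Dpos_dH_le (hV0 : V ∈ 𝓝 (0 : X)) (hV : V ⊆ orderInterval C A₁ A₂)
    {y : ℕ → X} (hyV : ∀ n, y n ∈ V) (hy : StrictConvexOn ℝ univ (quadSum y))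
    {τ : ℕ → WeakDual ℝ X} (hτ : LinearIndependent ℝ τ) (hτC : ∀ n, τ n ∈ posDual C)
    {K : HyperF X} (hK : K ∈ CUpos C) :
    ∃ B : X → ℝ, ∀ ε : ℝ, 0 < ε → ε ≤ 1 →
      ∃ G ∈ Dpos C, ∀ A, dH A G K ≤ ENNReal.ofReal (ε * B A) := by
  obtain ⟨φ, hφ, hdom⟩ := exists_dominating_posDual hV0 hV hτC
  obtain ⟨σ₀, hσ₀⟩ := K.2.1
  have hKc := isCompact_of_mem_CUpos hK
  have hKx := convex_of_mem_CUpos hK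
  have hKC := subset_posDual_of_mem_CUpos hK
  set N := dualInterval C φ with hN
  have hNc : IsCompact N := isCompact_dualInterval hV0 hV φ
  have hNx : Convex ℝ N := convex_dualInterval C φ
  have hN0 : (0 : WeakDual ℝ X) ∈ N := ⟨by simpa using hφ, by simpa using hφ⟩
  choose BK hBK0 hBK using exists_forall_abs_apply_le hKc
  choose BN hBN0 hBN using exists_forall_abs_apply_le hNc
  set e := A₂ - A₁ with he
  have hle : ∀ σ ∈ posDual C, ∀ n, |σ (y n)| ≤ σ e := fun σ hσ n =>
    abs_apply_le_of_mem_posDual (mem_of_mem_nhds hV0) hV hσ (hyV n)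
  have hKle : ∀ κ ∈ K.1, ∀ n, |κ (y n)| ≤ BK e := fun κ hκ n =>
    (hle κ (hKC hκ) n).trans ((le_abs_self _).trans (hBK e κ hκ))
  -- Elements of `N` need not be positive; the bound comes from writing $b=(\varphi+b)-\varphi$.
  have hNle : ∀ b ∈ N, ∀ n, |b (y n)| ≤ BN e + 2 * φ e := by
    intro b hb n
    have h1 : |φ (y n) + b (y n)| ≤ φ e + b e := hle _ hb.1 n
    have h2 := hle φ hφ n
    have h3 := (le_abs_self _).trans (hBN e b hb)
    rw [abs_le] at h1 h2 ⊢
    constructor <;> linarith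
  set M := 2 * BK e + (BN e + 2 * φ e) with hM
  refine ⟨fun A => |φ A| + BN A + 2 * BK A, fun ε hε hε1 => ?_⟩
  set L : Set (WeakDual ℝ X) := K.1 + {-σ₀} + ε • N with hL
  have hLmem : ∀ x, x ∈ L ↔ ∃ κ ∈ K.1, ∃ b ∈ N, x = κ + -σ₀ + ε • b := by
    intro x
    simp only [hL, mem_add, mem_smul_set, mem_singleton_iff]
    constructor
    · rintro ⟨_, ⟨κ, hκ, _, rfl, rfl⟩, _, ⟨b, hb, rfl⟩, rfl⟩
      exact ⟨κ, hκ, b, hb, rfl⟩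
    · rintro ⟨κ, hκ, b, hb, rfl⟩
      exact ⟨_, ⟨κ, hκ, _, rfl, rfl⟩, _, ⟨b, hb, rfl⟩, rfl⟩
  have hLc : IsCompact L := (hKc.add isCompact_singleton).add (hNc.smul ε)
  have hLx : Convex ℝ L := (hKx.add (convex_singleton _)).add (hNx.smul ε)
  have hKL : ∀ κ ∈ K.1, κ + -σ₀ ∈ L := fun κ hκ =>
    (hLmem _).2 ⟨κ, hκ, 0, hN0, by rw [smul_zero, add_zero]⟩
  have hNL : ∀ b ∈ N, ε • b ∈ L := fun b hb =>
    (hLmem _).2 ⟨σ₀, hσ₀, b, hb, by rw [add_neg_cancel, zero_add]⟩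
  have hL0 : (0 : WeakDual ℝ X) ∈ L := by simpa using hNL 0 hN0
  have hLM : L ⊆ {σ | ∀ n, |σ (y n)| ≤ M} := by
    intro x hx n
    obtain ⟨κ, hκ, b, hb, rfl⟩ := (hLmem x).1 hx
    have h1 := hKle κ hκ n
    have h2 := hKle σ₀ hσ₀ n
    have h3 := hNle b hb n
    have h4 : |ε * b (y n)| ≤ BN e + 2 * φ e := by
      rw [abs_mul, abs_of_pos hε]
      exact (mul_le_of_le_one_left (abs_nonneg _) hε1).trans h3
    change |κ (y n) + -σ₀ (y n) + ε * b (y n)| ≤ M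
    rw [abs_le] at h1 h2 h4 ⊢
    constructor <;> linarith
  -- `quadSum y` is at most $2M^2$ on `L`, so this makes $q\le\varepsilon$ there.
  set c := ε / (1 + 2 * M ^ 2) with hc
  have hc0 : 0 < c := by positivity
  set q : WeakDual ℝ X → ℝ := fun σ => c * quadSum y σ with hq
  have hq0 : ∀ σ, 0 ≤ q σ := fun σ => mul_nonneg hc0.le (quadSum_nonneg σ)
  have hqx : StrictConvexOn ℝ univ q := by
    refine ⟨convex_univ, fun σ hσ τ hτ hne a b ha hb hab => ?_⟩
    have := mul_lt_mul_of_pos_left (hy.2 hσ hτ hne ha hb hab) hc0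
    simp only [smul_eq_mul, hq] at this ⊢
    linarith
  have hqc : ContinuousOn q L := ((continuousOn_quadSum M).mono hLM).const_mul c
  have hqε : ∀ x ∈ L, q x ≤ ε := by
    intro x hx
    have h := quadSum_le (hLM hx)
    calc q x ≤ c * (1 + 2 * M ^ 2) := mul_le_mul_of_nonneg_left (by linarith) hc0.le
      _ = ε := div_mul_cancel₀ _ (by positivity)
  have habs : ∀ O ∈ 𝓝 (0 : WeakDual ℝ X), ∃ v ≠ (0 : WeakDual ℝ X), (∀ s : ℝ, s • v ∈ O) ∧
      ∃ r : ℝ, 0 < r ∧ v ∈ r • L := by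
    intro O hO
    obtain ⟨v, hv, hv0, hvO⟩ := exists_ne_zero_mem_span_of_nhds hτ hO
    obtain ⟨m, hm, h1, h2⟩ := exists_dominated_of_mem_span hφ hτC hdom hv
    have hm1 : 0 < m + 1 := by linarith
    have hm2 : m • φ + φ = (m + 1) • φ := by rw [add_smul, one_smul]
    -- `m` may vanish, hence the scaling by $m+1$.
    have hb : (m + 1)⁻¹ • v ∈ N := by
      constructor
      · convert smul_mem_posDual (inv_nonneg.2 hm1.le) (add_mem_posDual h1 hφ) using 1
        rw [add_right_comm, hm2, smul_add, inv_smul_smul₀ hm1.ne']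
      · convert smul_mem_posDual (inv_nonneg.2 hm1.le) (add_mem_posDual h2 hφ) using 1
        rw [sub_add_eq_add_sub, hm2, smul_sub, inv_smul_smul₀ hm1.ne']
    refine ⟨v, hv0, hvO, (m + 1) / ε, by positivity, mem_smul_set.2 ⟨_, hNL _ hb, ?_⟩⟩
    rw [smul_smul, smul_smul, div_mul_cancel₀ _ hε.ne', mul_inv_cancel₀ hm1.ne', one_smul]
  -- `σ₀` undoes the recentring of `K`, and $\varepsilon\varphi$ makes $\varepsilon N$ positive.
  set a := σ₀ + ε • φ with ha
  set S := gaugeAddSublevel L q with hS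
  have hSc : IsCompact S := isCompact_gaugeAddSublevel hLc hLx hL0 hq0 hqc
  have hSL : S ⊆ L := gaugeAddSublevel_subset hLx hL0 hq0
  set G : Set (WeakDual ℝ X) := (fun x => a + x) '' S with hG
  have hGc : IsCompact G := hSc.image (by fun_prop)
  have hGmem : ∀ g ∈ G, ∃ κ ∈ K.1, ∃ b ∈ N, g = κ + ε • (φ + b) := by
    rintro _ ⟨x, hx, rfl⟩
    obtain ⟨κ, hκ, b, hb, rfl⟩ := (hLmem x).1 (hSL hx)
    refine ⟨κ, hκ, b, hb, ?_⟩
    simp only [ha, smul_add]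
    abel
  -- The shrunken point has gauge at most $1-\varepsilon$, leaving room `ε` for `q`.
  have hKG : ∀ κ ∈ K.1, a + (1 - ε) • (κ + -σ₀) ∈ G := by
    refine fun κ hκ => mem_image_of_mem _ ⟨1 - ε, by linarith,
      smul_mem_smul_set (hKL κ hκ), ?_⟩
    have := hqε _ (hLx.smul_mem_of_zero_mem hL0 (hKL κ hκ) ⟨sub_nonneg.2 hε1, by linarith⟩)
    linarith
  have hGC : G ⊆ posDual C := by
    intro g hg
    obtain ⟨κ, hκ, b, hb, rfl⟩ := hGmem g hg
    exact add_mem_posDual (hKC hκ) (smul_mem_posDual hε.le hb.1)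
  have hGx : Convex ℝ G := (convex_gaugeAddSublevel hLx hqx.convexOn).translate a
  obtain ⟨U, hU, hGU⟩ := exists_subset_absPolar hV0 hV hGc hGC
  let G' : HyperF X := ⟨G, ⟨_, hKG σ₀ hσ₀⟩, hGc.isClosed⟩
  have hG' : G' ∈ CUpos C := mem_iUnion₂.2 ⟨U, hU, ⟨hGx, hGU⟩, hGC⟩
  refine ⟨G', (mem_Dpos_iff hG').2 (image_add_left_subset_closure_extremePoints a
    (gaugeAddSublevel_subset_closure_extremePoints hLc hLx hL0 hqx hq0 hqc habs)),
    fun A => dH_le (fun g hg => ?_) (fun κ hκ => ⟨_, hKG κ hκ, ?_⟩)⟩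
  · obtain ⟨κ, hκ, b, hb, rfl⟩ := hGmem g hg
    refine ⟨κ, hκ, ?_⟩
    change |κ A + ε * (φ A + b A) - κ A| ≤ _
    rw [add_sub_cancel_left, abs_mul, abs_of_pos hε]
    refine mul_le_mul_of_nonneg_left ?_ hε.le
    linarith [abs_add_le (φ A) (b A), hBN A b hb, hBK0 A]
  · change |σ₀ A + ε * φ A + (1 - ε) * (κ A + -σ₀ A) - κ A| ≤ _
    have heq : σ₀ A + ε * φ A + (1 - ε) * (κ A + -σ₀ A) - κ A = ε * (φ A + (σ₀ A - κ A)) := by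
      ring
    rw [heq, abs_mul, abs_of_pos hε]
    refine mul_le_mul_of_nonneg_left ?_ hε.le
    linarith [abs_add_le (φ A) (σ₀ A - κ A), abs_sub (σ₀ A) (κ A), hBK A κ hκ, hBK A σ₀ hσ₀,
      hBN0 A]

end Approximation

end WeakStarHyper

/-! ### Density and the $G_\delta$ property -/

open WeakStarHyper in
theorem mainTheorem4 {X : Type*} [AddCommGroup X] [Module ℝ X] [TopologicalSpace X]
    [IsTopologicalAddGroup X] [ContinuousSMul ℝ X] [LocallyConvexSpace ℝ X]
    [TopologicalSpace.SeparableSpace X] [TopologicalSpace.IsCompletelyMetrizableSpace X]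
    (C : ConvexCone ℝ X)
    (hC : ∀ U ∈ 𝓝 (0 : X), ∃ A₁ A₂ : X, ∃ V ∈ 𝓝 (0 : X),
      V ⊆ WeakStarHyper.orderInterval C A₁ A₂ ∧ WeakStarHyper.orderInterval C A₁ A₂ ⊆ U)
    (hinf : ∃ U ∈ 𝓝 (0 : X), WeakStarHyper.InfDimCondition U) :
    Dense {K : WeakStarHyper.CUpos C | (K : WeakStarHyper.HyperF X) ∈ WeakStarHyper.Dpos C} ∧
    IsGδ {K : WeakStarHyper.CUpos C | (K : WeakStarHyper.HyperF X) ∈ WeakStarHyper.Dpos C} := by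
  obtain ⟨A₁, A₂, V, hV0, hV, -⟩ := hC univ Filter.univ_mem
  obtain ⟨-, -, ρ, hρ, -⟩ := hinf
  obtain ⟨τ, hτ, hτC⟩ := exists_linearIndependent_posDual hC hρ
  have : Nonempty X := ⟨0⟩
  constructor
  · obtain ⟨y, hyV, hy⟩ := exists_separating_seq hV0
    have hstrict : StrictConvexOn ℝ univ (quadSum y) := by
      -- Continuous functionals are bounded on order intervals, hence along `y`, so the series
      -- converges everywhere.
      refine strictConvexOn_quadSum (fun σ => ?_) hy
      obtain ⟨M, hM⟩ := exists_forall_orderInterval_abs_le hC A₁ A₂ σ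
      exact ⟨M, fun n => hM _ (hV (hyV n))⟩
    rintro ⟨K, hK⟩
    obtain ⟨B, hB⟩ := exists_mem_Dpos_dH_le hV0 hV hyV hstrict hτ hτC hK
    choose G hG hGK using fun n : ℕ =>
      hB (1 / ((n : ℝ) + 1)) (by positivity) (by rw [div_le_one (by positivity)]; simp)
    have hlim : Filter.Tendsto G Filter.atTop (𝓝 K) := by
      refine tendsto_hyperF fun A => ?_
      have h0 : Filter.Tendsto (fun n : ℕ => ENNReal.ofReal (1 / ((n : ℝ) + 1) * B A))
          Filter.atTop (𝓝 0) := by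
        have := ENNReal.tendsto_ofReal
          ((tendsto_one_div_add_atTop_nhds_zero_nat (𝕜 := ℝ)).mul_const (B A))
        simpa using this
      exact tendsto_of_tendsto_of_tendsto_of_le_of_le tendsto_const_nhds h0
        (fun n => zero_le) (fun n => hGK n A)
    exact mem_closure_of_tendsto (f := fun n => (⟨G n, (hG n).2⟩ : CUpos C))
      (tendsto_subtype_rng.2 hlim) (Filter.Eventually.of_forall hG)
  · have heq : {K : CUpos C | (K : HyperF X) ∈ Dpos C} =
        ⋂ s ∈ {s : Finset (ℕ × ℚ × ℚ) | ∀ p ∈ s, p.2.1 < p.2.2},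
          {K : CUpos C | SliceCondition (TopologicalSpace.denseSeq X) s K.1.1} := by
      ext ⟨K, hK⟩
      simp only [mem_ofPred_eq, mem_iInter]
      rw [mem_Dpos_iff hK, subset_closure_extremePoints_iff
        (TopologicalSpace.denseRange_denseSeq X) (isCompact_of_mem_CUpos hK)
        (convex_of_mem_CUpos hK)]
    rw [heq]
    refine IsGδ.biInter_of_isOpen (to_countable _) fun s _ => ?_
    refine isOpen_iff_mem_nhds.2 fun K hK => ?_
    exact continuousAt_subtype_val.eventually
      (eventually_sliceCondition (isCompact_of_mem_CUpos K.2) (convex_of_mem_CUpos K.2) hK)
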